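/- Theorem (recurrence for $M_k$). A permutation $\pi\in\mathcal S_n$ contains $\sigma\in\mathcal S_m$ if there are indices $i_1<\dots<i_m$ such that $\pi_{i_1}\cdots\pi_{i_m}$ is in the same relative order as $\sigma_1\cdots\sigma_m$; otherwise $\pi$ avoids $\sigma$. For $k\ge 0$ let $\mathcal S_n(132,12\cdots(k+1))$ be the set of permutations in $\mathcal S_n$ avoiding both $132$ and $12\cdots(k+1)$, let $\mathrm{fp}(\pi)$ be the number of fixed points of $\pi$, and let $$M_k(x,z)=\sum_{n\ge0}\ \sum_{\pi\in\mathcal S_n(132,12\cdots(k+1))}x^{\mathrm{fp}(\pi)}z^n,\qquad M_{-1}(x,z)=0,$$ regarded as formal power series in $z$ with coefficients in $\mathbb Q[x]$. Let $U_m$ be the Chebyshev polynomials of the second kind, given by $U_0(t)=1$, $U_1(t)=2t$, $U_r(t)=2tU_{r-1}(t)-U_{r-2}(t)$. Then for all $0\le\ell\le k$ the element $\dfrac{U_\ell(1/(2z))}{z\,U_{k+1}(1/(2z))}$ of the field $\mathbb Q((z))$ is well defined and is a formal power series $$\frac{U_\ell(1/(2z))}{z\,U_{k+1}(1/(2z))}=\sum_{n\ge0}g_{k,\ell}(n)z^n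 ,$$ and, with $G_{k,\ell}(z)=\sum_{n\ge0}g_{k,\ell}(n)^2z^n$, for every $k\ge0$, $$M_k(x,z)=\sum_{\ell=0}^{k}G_{k,\ell}(z)\bigl(1+(x-1)\,z\,M_{\ell-1}(x,z)\bigr).$$ -/

import Mathlib

namespace PatternAvoid

/-- A permutation pattern: a permutation of `{1, …, m}` (indexed by `Fin m`) together with its
length `m`. -/
abbrev Pattern : Type := (m : ℕ) × Equiv.Perm (Fin m)

/-- `π` contains `σ` if there are indices `i₁ < ⋯ < iₘ` such that `π(i₁) ⋯ π(iₘ)` is in the same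
relative order as `σ(1) ⋯ σ(m)`. -/
def Contains {n : ℕ} (π : Equiv.Perm (Fin n)) (σ : Pattern) : Prop :=
  ∃ i : Fin σ.1 → Fin n, StrictMono i ∧ ∀ a b, π (i a) < π (i b) ↔ σ.2 a < σ.2 b

open Classical in
/-- `S_n(P)`: the permutations in `S_n` avoiding every pattern in `P`. -/
noncomputable def avoiders (P : Set Pattern) (n : ℕ) : Finset (Equiv.Perm (Fin n)) :=
  Finset.univ.filter fun π => ∀ σ ∈ P, ¬ Contains π σ

/-- The number of fixed points. -/
def fp {n : ℕ} (π : Equiv.Perm (Fin n)) : ℕ := (Finset.univ.filter fun i => π i = i).card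

/-- The number of excedances. -/
def exc {n : ℕ} (π : Equiv.Perm (Fin n)) : ℕ := (Finset.univ.filter fun i => i < π i).card

/-- `F_P(x, q, z) = ∑_{n ≥ 0} ∑_{π ∈ S_n(P)} x^{fp π} q^{exc π} z^n`, a formal power series in `z`
for elements `x`, `q` of any commutative ring. -/
noncomputable def F {R : Type*} [CommRing R] (P : Set Pattern) (x q : R) : PowerSeries R :=
  PowerSeries.mk fun n => ∑ π ∈ avoiders P n, x ^ fp π * q ^ exc π

/-- The pattern `132`. -/
def pattern132 : Pattern := ⟨3, Equiv.swap 1 2⟩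

/-- The increasing pattern `12⋯m`. -/
def increasing (m : ℕ) : Pattern := ⟨m, Equiv.refl (Fin m)⟩

/-- `M_k(x, z) = F_{132, 12⋯(k+1)}(x, 1, z)` for `k ≥ 0`, a power series in `z` over `ℚ[x]`;
`M_{-1} = 0`. (Smaller indices do not occur.) -/
noncomputable def M : ℤ → PowerSeries (Polynomial ℚ)
  | Int.ofNat k => F {pattern132, increasing (k + 1)} Polynomial.X 1
  | Int.negSucc _ => 0

/-- The variable `z`, as a Laurent series. -/
noncomputable def zL : LaurentSeries ℚ := HahnSeries.single 1 1

/-- `U_m(1/(2z))` in the field `ℚ((z))`, where `U_m` is the Chebyshev polynomial of the second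
kind. -/
noncomputable def UL (m : ℕ) : LaurentSeries ℚ :=
  Polynomial.aeval (1 / (2 * zL)) (Polynomial.Chebyshev.U ℚ (m : ℤ))

/-- `U_ℓ(1/(2z)) / (z U_{k+1}(1/(2z)))` in the field `ℚ((z))`. -/
noncomputable def Gtilde (k l : ℕ) : LaurentSeries ℚ := UL l / (zL * UL (k + 1))

/-- `g_{k,ℓ}(n)`: the coefficient of `z^n` in `U_ℓ(1/(2z)) / (z U_{k+1}(1/(2z)))`. -/
noncomputable def g (k l n : ℕ) : ℚ := (Gtilde k l).coeff (n : ℤ)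

/-- `G_{k,ℓ}(z) = ∑_{n ≥ 0} g_{k,ℓ}(n)² z^n`, as a power series over `ℚ[x]`. -/
noncomputable def G (k l : ℕ) : PowerSeries (Polynomial ℚ) :=
  PowerSeries.mk fun n => Polynomial.C (g k l n ^ 2)

end PatternAvoid

/-!
Since `x ^ fp π = 1 + (x - 1) * ∑ x ^ fpBelow π i`, summed over the fixed points `i` of `π`, it is
enough to count the avoiders and the avoiders with a marked fixed point `i`. In the second case
let `q` be the number of `t < i` with `π t > i`, and let `r + 1` be the number of points weakly
above and to the right of `(i, i)`. Avoiding `132` forces `π` to map the first `q` positions above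
`i` and to permute the `p + 1` positions `q, …, i` among themselves, fixing the last of them. This
block avoids `12⋯(k-r+1)`, because the `r` points beyond it are increasing and extend each of its
increasing subsequences; up to its last point it is thus an arbitrary object counted by
`M_{k-r-1}`. The rest of `π` is determined by the pattern of the points above the block and the
pattern of the points to its right, which share these `r` points and are otherwise independent.

Each of the two patterns is an avoider of length `q + r` that is increasing from position `q` on
(after inverting the second one). Keeping track of where the value `0` is inserted identifies these
with walks of `2 * q + r` steps `±1` from `0` to `r` inside `[0, k]`. Solving the linear system for
the generating functions of such walks gives `U_ℓ / (z U_{k+1})` with `ℓ = k - r`. All avoiders of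
length `n` correspond to the walks of `2 * n` steps from `0` to `0`, and cutting these walks in the
middle gives `∑ g_{k,ℓ}(n)²`.
-/

namespace PatternAvoid

open Finset
open Equiv (Perm)

section NorthEast

variable {ι κ : Type*} [LinearOrder ι] [LinearOrder κ]

theorem strictMonoOn_map_union_iff {σ : Perm ι} {π : Perm κ} {e : ι ↪o κ} {T : Finset κ}
    (hσπ : ∀ u v, π (e u) < π (e v) ↔ σ u < σ v) (hT : StrictMonoOn π T)
    (heT : ∀ u, ∀ t ∈ T, e u < t ∧ π (e u) < π t) {s : Finset ι} :
    StrictMonoOn π ↑(s.map e.toEmbedding ∪ T) ↔ StrictMonoOn σ s := by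
  simp only [StrictMonoOn, mem_coe, mem_union, mem_map, RelEmbedding.coe_toEmbedding]
  constructor
  · intro h u hu v hv huv
    exact (hσπ u v).1 (h (Or.inl ⟨u, hu, rfl⟩) (Or.inl ⟨v, hv, rfl⟩) (e.lt_iff_lt.2 huv))
  · rintro h _ (⟨u, hu, rfl⟩ | hx) _ (⟨v, hv, rfl⟩ | hy) hxy
    · exact (hσπ u v).2 (h hu hv (e.lt_iff_lt.1 hxy))
    · exact (heT u _ hy).2
    · exact absurd hxy (heT v _ hx).1.not_gt
    · exact hT hx hy hxy

variable [Fintype ι] [Fintype κ] {k : ℕ}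

/-- The positions of the points of the graph of `π` that lie weakly to the north-east (above and to
the right) of the point at position `a`. -/
def northEast (π : Perm ι) (a : ι) : Finset ι := {b | a ≤ b ∧ π a ≤ π b}

/-- The points weakly to the north-east of the one at position `a` form an increasing sequence of
length at most `k`. -/
def NorthEastChain (k : ℕ) (π : Perm ι) (a : ι) : Prop :=
  StrictMonoOn π (northEast π a) ∧ #(northEast π a) ≤ k

/-- Simultaneous avoidance of `132` and `12⋯(k+1)`, in the local form that is convenient for
cutting permutations into blocks; see `mem_avoiders_iff_isAvoider`. -/
def IsAvoider (k : ℕ) (π : Perm ι) : Prop := ∀ a, NorthEastChain k π a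

theorem mem_northEast {π : Perm ι} {a b : ι} : b ∈ northEast π a ↔ a ≤ b ∧ π a ≤ π b := by
  simp only [northEast, mem_filter_univ]

theorem self_mem_northEast (π : Perm ι) (a : ι) : a ∈ northEast π a :=
  mem_northEast.2 ⟨le_rfl, le_rfl⟩

theorem not_isAvoider_zero [Nonempty ι] (π : Perm ι) : ¬ IsAvoider 0 π := fun h =>
  let a := Classical.arbitrary ι
  (card_pos.2 ⟨a, self_mem_northEast π a⟩).not_ge (h a).2

theorem northEast_symm (π : Perm ι) (a : ι) :
    northEast π.symm (π a) = (northEast π a).map π.toEmbedding := by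
  ext x
  simp [mem_northEast, mem_map_equiv, and_comm]

theorem NorthEastChain.symm {π : Perm ι} {a : ι} (h : NorthEastChain k π a) :
    NorthEastChain k π.symm (π a) := by
  rw [NorthEastChain, northEast_symm, card_map]
  refine ⟨fun x hx y hy hxy => ?_, h.2⟩
  rw [mem_coe, mem_map_equiv] at hx hy
  rw [← h.1.lt_iff_lt hx hy]
  simpa only [Equiv.apply_symm_apply] using hxy

theorem northEastChain_symm_iff {π : Perm ι} {a : ι} :
    NorthEastChain k π.symm (π a) ↔ NorthEastChain k π a :=
  ⟨fun h => by simpa only [Equiv.symm_symm, Equiv.symm_apply_apply] using h.symm, fun h => h.symm⟩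

theorem IsAvoider.symm {π : Perm ι} (h : IsAvoider k π) : IsAvoider k π.symm := fun a => by
  simpa only [Equiv.apply_symm_apply] using (h (π.symm a)).symm

section Transfer

variable {σ : Perm ι} {π : Perm κ} {e : ι ↪o κ} {T : Finset κ} {a : ι}

theorem northEast_eq_map_union (hσπ : ∀ u v, π (e u) < π (e v) ↔ σ u < σ v)
    (heT : ∀ u, ∀ t ∈ T, e u < t ∧ π (e u) < π t)
    (hNE : ∀ x ∈ northEast π (e a), x ∈ Set.range e ∨ x ∈ T) :
    northEast π (e a) = (northEast σ a).map e.toEmbedding ∪ T := by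
  have hle : ∀ u v, π (e u) ≤ π (e v) ↔ σ u ≤ σ v := fun u v => by
    rw [← not_lt, hσπ, not_lt]
  have hmem : ∀ u, e u ∈ northEast π (e a) ↔ u ∈ northEast σ a := fun u => by
    simp only [mem_northEast, e.le_iff_le, hle]
  ext x
  simp only [mem_union, mem_map, RelEmbedding.coe_toEmbedding]
  constructor
  · intro hx
    rcases hNE x hx with ⟨u, rfl⟩ | hxT
    · exact Or.inl ⟨u, (hmem u).1 hx, rfl⟩
    · exact Or.inr hxT
  · rintro (⟨u, hu, rfl⟩ | hxT)
    · exact (hmem u).2 hu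
    · exact mem_northEast.2 ⟨(heT a x hxT).1.le, (heT a x hxT).2.le⟩

theorem northEastChain_add_card_iff (hσπ : ∀ u v, π (e u) < π (e v) ↔ σ u < σ v)
    (hT : StrictMonoOn π T) (heT : ∀ u, ∀ t ∈ T, e u < t ∧ π (e u) < π t)
    (hNE : ∀ x ∈ northEast π (e a), x ∈ Set.range e ∨ x ∈ T) :
    NorthEastChain (k + #T) π (e a) ↔ NorthEastChain k σ a := by
  have hdisj : Disjoint ((northEast σ a).map e.toEmbedding) T := by
    rw [disjoint_left]
    rintro _ hx hxT
    obtain ⟨u, -, rfl⟩ := mem_map.1 hx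
    exact (heT u _ hxT).1.false
  rw [NorthEastChain, NorthEastChain, northEast_eq_map_union hσπ heT hNE,
    strictMonoOn_map_union_iff hσπ hT heT, card_union_of_disjoint hdisj, card_map,
    Nat.add_le_add_iff_right]

theorem northEastChain_map_iff (hσπ : ∀ u v, π (e u) < π (e v) ↔ σ u < σ v)
    (hNE : ∀ x ∈ northEast π (e a), x ∈ Set.range e) :
    NorthEastChain k π (e a) ↔ NorthEastChain k σ a := by
  simpa only [card_empty, add_zero] using northEastChain_add_card_iff (k := k) (T := ∅) hσπ
    (fun _ hx => absurd hx (notMem_empty _)) (fun _ _ ht => absurd ht (notMem_empty _))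
    (fun x hx => Or.inl (hNE x hx))

end Transfer

end NorthEast

section Avoidance

variable {n k : ℕ} {π : Perm (Fin n)}

theorem contains_pattern132_iff :
    Contains π pattern132 ↔ ∃ a b c, a < b ∧ b < c ∧ π a < π c ∧ π c < π b := by
  constructor
  · rintro ⟨i, hi, h⟩
    change ∀ a b : Fin 3, _ at h
    change StrictMono (i : Fin 3 → Fin n) at hi
    exact ⟨i (0 : Fin 3), i (1 : Fin 3), i (2 : Fin 3), hi (by decide), hi (by decide),
      (h 0 2).2 (by decide), (h 2 1).2 (by decide)⟩
  · rintro ⟨a, b, c, hab, hbc, hac, hcb⟩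
    refine ⟨(![a, b, c] : Fin 3 → Fin n), ?_, ?_⟩
    · change StrictMono (![a, b, c] : Fin 3 → Fin n)
      rw [Fin.strictMono_iff_lt_succ]
      intro i
      fin_cases i
      exacts [hab, hbc]
    · have hmono : StrictMono (π ∘ ![a, b, c] ∘ Equiv.swap (1 : Fin 3) 2) := by
        rw [Fin.strictMono_iff_lt_succ]
        intro i
        fin_cases i
        exacts [hac, hcb]
      change ∀ u v : Fin 3, π (![a, b, c] u) < π (![a, b, c] v) ↔
        Equiv.swap (1 : Fin 3) 2 u < Equiv.swap (1 : Fin 3) 2 v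
      intro u v
      simpa only [Function.comp_apply, Equiv.swap_apply_self] using
        hmono.lt_iff_lt (a := Equiv.swap 1 2 u) (b := Equiv.swap 1 2 v)

theorem contains_increasing_iff {m : ℕ} :
    Contains π (increasing m) ↔ ∃ s : Finset (Fin n), #s = m ∧ StrictMonoOn π s := by
  constructor
  · rintro ⟨i, hi, h⟩
    change Fin m → Fin n at i
    refine ⟨univ.map ⟨i, hi.injective⟩, by rw [card_map, card_univ, Fintype.card_fin], ?_⟩
    intro x hx y hy hxy
    obtain ⟨u, -, rfl⟩ := mem_map.1 hx
    obtain ⟨v, -, rfl⟩ := mem_map.1 hy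
    exact (h u v).2 (hi.lt_iff_lt.1 hxy)
  · rintro ⟨s, hs, h⟩
    refine ⟨s.orderEmbOfFin hs, (s.orderEmbOfFin hs).strictMono, fun u v => ?_⟩
    exact (h.lt_iff_lt (s.orderEmbOfFin_mem hs u) (s.orderEmbOfFin_mem hs v)).trans
      (OrderEmbedding.lt_iff_lt _)

theorem contains_pattern132_iff_exists_not_strictMonoOn :
    Contains π pattern132 ↔ ∃ a, ¬ StrictMonoOn π (northEast π a) := by
  rw [contains_pattern132_iff]
  constructor
  · rintro ⟨a, b, c, hab, hbc, hac, hcb⟩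
    refine ⟨a, fun h => hcb.not_gt (h ?_ ?_ hbc)⟩
    · exact mem_northEast.2 ⟨hab.le, (hac.trans hcb).le⟩
    · exact mem_northEast.2 ⟨(hab.trans hbc).le, hac.le⟩
  · rintro ⟨a, h⟩
    simp only [StrictMonoOn, mem_coe, mem_northEast, not_forall, not_lt] at h
    obtain ⟨b, hb, c, hc, hbc, hle⟩ := h
    have hcb : π c < π b := hle.lt_of_ne (π.injective.ne hbc.ne')
    have hab : a < b := hb.1.lt_of_ne fun hab => hcb.not_ge (hab ▸ hc.2)
    exact ⟨a, b, c, hab, hbc, hc.2.lt_of_ne (π.injective.ne (hab.trans hbc).ne), hcb⟩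

theorem mem_avoiders_iff_isAvoider :
    π ∈ avoiders {pattern132, increasing (k + 1)} n ↔ IsAvoider k π := by
  simp only [avoiders, mem_filter_univ, Set.mem_insert_iff, Set.mem_singleton_iff,
    forall_eq_or_imp, forall_eq, contains_pattern132_iff_exists_not_strictMonoOn, not_exists,
    not_not, contains_increasing_iff]
  constructor
  · rintro ⟨hmono, hcard⟩ a
    refine ⟨hmono a, not_lt.1 fun hk => ?_⟩
    obtain ⟨s, hs, hsk⟩ := exists_subset_card_eq (Nat.succ_le_of_lt hk)
    exact hcard s ⟨hsk, (hmono a).mono (coe_subset.2 hs)⟩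
  · refine fun h => ⟨fun a => (h a).1, ?_⟩
    rintro s ⟨hs, hmono⟩
    have hne : s.Nonempty := card_pos.1 (by omega)
    have hsub : s ⊆ northEast π (s.min' hne) := fun x hx =>
      mem_northEast.2 ⟨s.min'_le x hx, hmono.monotoneOn (s.min'_mem hne) hx (s.min'_le x hx)⟩
    have := (card_le_card hsub).trans (h _).2
    omega

end Avoidance

section InsertPoint

theorem perm_eq_of_strictMonoOn {ι : Type*} [LinearOrder ι] [WellFoundedLT ι] {π ρ : Perm ι}
    {S : Set ι} (hπ : StrictMonoOn π S) (hρ : StrictMonoOn ρ S) (h : Set.EqOn π ρ Sᶜ) : π = ρ := by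
  have himage : π '' S = ρ '' S := by
    rw [← compl_inj_iff, ← Set.image_compl_eq π.bijective, ← Set.image_compl_eq ρ.bijective,
      h.image_eq]
  have hrestrict : S.domRestrict π = S.domRestrict ρ := by
    rw [← hπ.domRestrict.range_inj hρ.domRestrict, Set.range_domRestrict,
      Set.range_domRestrict, himage]
  ext1 t
  by_cases ht : t ∈ S
  · exact congrFun hrestrict ⟨t, ht⟩
  · exact h ht

variable {n k : ℕ}

/-- The permutation obtained from `σ` by inserting the value `v` at position `p`. -/
def insertPoint (p v : Fin (n + 1)) (σ : Perm (Fin n)) : Perm (Fin (n + 1)) :=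
  (finSuccEquiv' p).trans ((Equiv.optionCongr σ).trans (finSuccEquiv' v).symm)

@[simp]
theorem insertPoint_self (p v : Fin (n + 1)) (σ : Perm (Fin n)) : insertPoint p v σ p = v := by
  simp [insertPoint]

@[simp]
theorem insertPoint_succAbove (p v : Fin (n + 1)) (σ : Perm (Fin n)) (j : Fin n) :
    insertPoint p v σ (p.succAbove j) = v.succAbove (σ j) := by
  simp [insertPoint]

theorem insertPoint_succAbove_lt_iff {p v : Fin (n + 1)} {σ : Perm (Fin n)} {a b : Fin n} :
    insertPoint p v σ (p.succAbove a) < insertPoint p v σ (p.succAbove b) ↔ σ a < σ b := by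
  rw [insertPoint_succAbove, insertPoint_succAbove, Fin.succAbove_lt_succAbove_iff]

theorem insertPoint_injective (p v : Fin (n + 1)) :
    Function.Injective (insertPoint (n := n) p v) := fun σ τ h => by
  ext1 j
  simpa only [insertPoint_succAbove, Fin.succAbove_right_inj]
    using congrArg (fun f : Perm (Fin (n + 1)) => f (p.succAbove j)) h

theorem exists_eq_insertPoint {p v : Fin (n + 1)} {π : Perm (Fin (n + 1))} (h : π p = v) :
    ∃ σ, π = insertPoint p v σ := by
  have hne : ∀ j, ∃ i, v.succAbove i = π (p.succAbove j) := fun j => by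
    rw [Fin.exists_succAbove_eq_iff, ← h]
    exact π.injective.ne (Fin.succAbove_ne p j)
  choose f hf using hne
  have hinj : Function.Injective f := fun i j hij => by
    have hπ : π (p.succAbove i) = π (p.succAbove j) := by rw [← hf, ← hf, hij]
    exact Fin.succAbove_right_injective (π.injective hπ)
  refine ⟨Equiv.ofBijective f (Finite.injective_iff_bijective.1 hinj), ?_⟩
  ext1 x
  rcases Fin.eq_self_or_eq_succAbove p x with rfl | ⟨j, rfl⟩
  · rw [h, insertPoint_self]
  · rw [insertPoint_succAbove, Equiv.ofBijective_apply, hf]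

theorem northEastChain_insertPoint_last_iff {σ : Perm (Fin n)} {a : Fin n} :
    NorthEastChain (k + 1) (insertPoint (Fin.last n) (Fin.last n) σ) ((Fin.last n).succAbove a) ↔
      NorthEastChain k σ a := by
  refine northEastChain_add_card_iff (T := {Fin.last n}) (e := Fin.succAboveOrderEmb (Fin.last n))
    (fun _ _ => insertPoint_succAbove_lt_iff) ?_ ?_ ?_
  · rw [coe_singleton]
    exact Set.strictMonoOn_singleton _
  · intro u t ht
    rw [mem_singleton.1 ht, Fin.succAboveOrderEmb_apply, insertPoint_succAbove, insertPoint_self,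
      Fin.succAbove_last]
    exact ⟨Fin.castSucc_lt_last _, Fin.castSucc_lt_last _⟩
  · rintro x -
    rcases Fin.eq_self_or_eq_succAbove (Fin.last n) x with rfl | ⟨j, rfl⟩
    · exact Or.inr (mem_singleton_self _)
    · exact Or.inl ⟨j, rfl⟩

theorem isAvoider_insertPoint_last_iff {σ : Perm (Fin n)} :
    IsAvoider (k + 1) (insertPoint (Fin.last n) (Fin.last n) σ) ↔ IsAvoider k σ := by
  refine ⟨fun h a => northEastChain_insertPoint_last_iff.1 (h _), fun h x => ?_⟩
  rcases Fin.eq_self_or_eq_succAbove (Fin.last n) x with rfl | ⟨j, rfl⟩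
  · have hlast :
        northEast (insertPoint (Fin.last n) (Fin.last n) σ) (Fin.last n) = {Fin.last n} :=
      subset_antisymm (fun y hy => mem_singleton.2 (Fin.last_le_iff.1 (mem_northEast.1 hy).1))
        (singleton_subset_iff.2 (self_mem_northEast _ _))
    rw [NorthEastChain, hlast, coe_singleton, card_singleton]
    exact ⟨Set.strictMonoOn_singleton _, Nat.le_add_left 1 k⟩
  · exact northEastChain_insertPoint_last_iff.2 (h j)

end InsertPoint

section TailAvoiders

variable {k q n : ℕ}

open Classical in
/-- The permutations of length `n` avoiding `132` and `12⋯(k+1)` that are increasing on the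
positions from `q` on. -/
noncomputable def tailAvoiders (k q n : ℕ) : Finset (Perm (Fin n)) :=
  {π | IsAvoider k π ∧ StrictMonoOn π {t | q ≤ t.val}}

theorem mem_tailAvoiders {π : Perm (Fin n)} :
    π ∈ tailAvoiders k q n ↔ IsAvoider k π ∧ StrictMonoOn π {t | q ≤ t.val} := by
  simp only [tailAvoiders, mem_filter_univ]

theorem le_add_of_mem_tailAvoiders {π : Perm (Fin n)} (h : π ∈ tailAvoiders k q n) :
    n ≤ q + k := by
  rw [mem_tailAvoiders] at h
  rcases le_or_gt n q with hq | hq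
  · omega
  · have hsub : Ici (⟨q, hq⟩ : Fin n) ⊆ northEast π ⟨q, hq⟩ := fun x hx =>
      mem_northEast.2 ⟨mem_Ici.1 hx, h.2.monotoneOn (le_refl q) (mem_Ici.1 hx) (mem_Ici.1 hx)⟩
    have hcard := (card_le_card hsub).trans (h.1 _).2
    rw [Fin.card_Ici] at hcard
    exact Nat.sub_le_iff_le_add'.1 hcard

theorem card_tailAvoiders_eq_zero (h : q + k < n) : #(tailAvoiders k q n) = 0 := by
  rw [card_eq_zero, eq_empty_iff_forall_notMem]
  exact fun π hπ => h.not_ge (le_add_of_mem_tailAvoiders hπ)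

theorem card_tailAvoiders_zero (h : n ≤ k) : #(tailAvoiders k 0 n) = 1 := by
  rw [card_eq_one]
  refine ⟨1, ?_⟩
  have hone : ∀ s : Set (Fin n), StrictMonoOn (1 : Perm (Fin n)) s := fun _ _ _ _ _ hab => hab
  ext π
  rw [mem_tailAvoiders, mem_singleton]
  constructor
  · rintro ⟨-, hπ⟩
    exact perm_eq_of_strictMonoOn hπ (hone _) fun t ht => absurd (Nat.zero_le t.val) ht
  · rintro rfl
    exact ⟨fun a => ⟨hone _, (card_le_univ _).trans (by rwa [Fintype.card_fin])⟩, hone _⟩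

theorem tailAvoiders_succ_self (k n : ℕ) :
    tailAvoiders k (n + 1) (n + 1) = tailAvoiders k n (n + 1) := by
  ext π
  rw [mem_tailAvoiders, mem_tailAvoiders]
  refine and_congr_right fun _ => iff_of_true (fun a ha => absurd a.2 (not_lt.2 ha)) ?_
  intro a (ha : n ≤ a) b _ (hab : a.val < b.val)
  omega

theorem le_succAbove_iff {p : Fin (n + 1)} {j : Fin n} : p ≤ p.succAbove j ↔ p.val ≤ j.val := by
  rw [(Fin.succAbove_ne p j).symm.le_iff_lt, Fin.lt_succAbove_iff_le_castSucc, Fin.le_def,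
    Fin.val_castSucc]

theorem strictMonoOn_insertPoint_zero_iff {p : Fin (n + 1)} {σ : Perm (Fin n)} :
    StrictMonoOn (insertPoint p 0 σ) {t | p ≤ t} ↔ StrictMonoOn σ {t | p.val ≤ t.val} := by
  constructor
  · intro h a ha b hb hab
    exact insertPoint_succAbove_lt_iff.1
      (h (le_succAbove_iff.2 ha) (le_succAbove_iff.2 hb) (Fin.strictMono_succAbove p hab))
  · intro h x hx y hy hxy
    rcases Fin.eq_self_or_eq_succAbove p y with rfl | ⟨b, rfl⟩
    · exact absurd hx hxy.not_ge
    rcases Fin.eq_self_or_eq_succAbove p x with rfl | ⟨a, rfl⟩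
    · rw [insertPoint_self, insertPoint_succAbove, Fin.zero_succAbove]
      exact Fin.succ_pos _
    · exact insertPoint_succAbove_lt_iff.2
        (h (le_succAbove_iff.1 hx) (le_succAbove_iff.1 hy) (Fin.succAbove_lt_succAbove_iff.1 hxy))

theorem northEastChain_insertPoint_zero_iff {p : Fin (n + 1)} {σ : Perm (Fin n)} {a : Fin n} :
    NorthEastChain k (insertPoint p 0 σ) (p.succAbove a) ↔ NorthEastChain k σ a := by
  refine northEastChain_map_iff (e := Fin.succAboveOrderEmb p)
    (fun _ _ => insertPoint_succAbove_lt_iff) fun x hx => ?_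
  rcases Fin.eq_self_or_eq_succAbove p x with rfl | ⟨j, rfl⟩
  · have hle := (mem_northEast.1 hx).2
    rw [Fin.succAboveOrderEmb_apply, insertPoint_succAbove, insertPoint_self,
      Fin.zero_succAbove] at hle
    exact absurd hle (Fin.succ_pos _).not_ge
  · exact ⟨j, rfl⟩

theorem insertPoint_zero_mem_tailAvoiders_iff {p : Fin (n + 1)} (hk : n + 1 ≤ p + k)
    {σ : Perm (Fin n)} :
    insertPoint p 0 σ ∈ tailAvoiders k p (n + 1) ↔ σ ∈ tailAvoiders k p n := by
  rw [mem_tailAvoiders, mem_tailAvoiders]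
  simp only [Fin.val_fin_le]
  rw [strictMonoOn_insertPoint_zero_iff]
  refine and_congr_left fun hσ =>
    ⟨fun h a => northEastChain_insertPoint_zero_iff.1 (h _), fun h x => ?_⟩
  rcases Fin.eq_self_or_eq_succAbove p x with rfl | ⟨j, rfl⟩
  · have hnorthEast : northEast (insertPoint x 0 σ) x = Ici x := by
      ext y
      simp only [mem_northEast, insertPoint_self, Fin.zero_le, and_true, mem_Ici]
    rw [NorthEastChain, hnorthEast, Fin.card_Ici, coe_Ici]
    exact ⟨strictMonoOn_insertPoint_zero_iff.2 hσ, by omega⟩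
  · exact northEastChain_insertPoint_zero_iff.2 (h j)

theorem apply_lt_of_ne_zero {p r : Fin (n + 1)} (hpr : r.val + 1 = p) {π : Perm (Fin (n + 1))}
    (hπ : π ∈ tailAvoiders k p (n + 1)) (h0 : π p ≠ 0) : π r < π p := by
  rw [mem_tailAvoiders] at hπ
  have hrp : r < p := Fin.lt_def.2 (by omega)
  obtain ⟨a, ha⟩ := π.surjective 0
  have hnorthEast : ∀ x, a ≤ x → x ∈ northEast π a := fun x hx =>
    mem_northEast.2 ⟨hx, ha ▸ Fin.zero_le _⟩
  rcases lt_trichotomy a p with hap | rfl | hpa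
  · exact (hπ.1 a).1 (hnorthEast r (Fin.le_def.2 (by omega))) (hnorthEast p hap.le) hrp
  · exact absurd ha h0
  · exact absurd (hπ.2 (le_refl p.val) hpa.le hpa) (by simp [ha])

theorem strictMonoOn_tail_iff {p r : Fin (n + 1)} (hpr : r.val + 1 = p)
    {π : Perm (Fin (n + 1))} (hπ : π ∈ tailAvoiders k p (n + 1)) :
    StrictMonoOn π {t | r.val ≤ t.val} ↔ π p ≠ 0 := by
  have hrp : r < p := Fin.lt_def.2 (by omega)
  constructor
  · exact fun h => Fin.ne_zero_of_lt (h (le_refl r.val) hrp.le hrp)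
  · intro h0
    have htail := (mem_tailAvoiders.1 hπ).2
    intro x (hx : r ≤ x) y _ hxy
    have hpy : p.val ≤ y.val := by omega
    rcases hx.eq_or_lt with rfl | hx
    · exact (apply_lt_of_ne_zero hpr hπ h0).trans_le
        (htail.monotoneOn (le_refl p.val) hpy (Fin.le_def.2 hpy))
    · exact htail (show p.val ≤ x.val by omega) hpy hxy

theorem card_tailAvoiders_succ_succ (hq : q + 1 ≤ n) (hk : n ≤ q + k) :
    #(tailAvoiders k (q + 1) (n + 1)) =
      #(tailAvoiders k (q + 1) n) + #(tailAvoiders k q (n + 1)) := by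
  classical
  let p : Fin (n + 1) := ⟨q + 1, by omega⟩
  let r : Fin (n + 1) := ⟨q, by omega⟩
  have hzero : {π ∈ tailAvoiders k p (n + 1) | π p = 0} =
      (tailAvoiders k p n).map ⟨insertPoint p 0, insertPoint_injective p 0⟩ := by
    ext π
    simp only [mem_filter, mem_map, Function.Embedding.coeFn_mk]
    constructor
    · rintro ⟨h, h0⟩
      obtain ⟨σ, rfl⟩ := exists_eq_insertPoint h0
      exact ⟨σ, (insertPoint_zero_mem_tailAvoiders_iff (by simp only [p]; omega)).1 h, rfl⟩
    · rintro ⟨σ, h, rfl⟩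
      exact ⟨(insertPoint_zero_mem_tailAvoiders_iff (by simp only [p]; omega)).2 h,
        insertPoint_self _ _ _⟩
  have hne : {π ∈ tailAvoiders k p (n + 1) | ¬ π p = 0} = tailAvoiders k r (n + 1) := by
    ext π
    rw [mem_filter]
    constructor
    · rintro ⟨h, h0⟩
      exact mem_tailAvoiders.2 ⟨(mem_tailAvoiders.1 h).1, (strictMonoOn_tail_iff rfl h).2 h0⟩
    · intro h
      rw [mem_tailAvoiders] at h
      have hp : π ∈ tailAvoiders k p (n + 1) :=
        mem_tailAvoiders.2 ⟨h.1, h.2.mono fun x hx => (Nat.le_succ q).trans hx⟩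
      exact ⟨hp, (strictMonoOn_tail_iff rfl hp).1 h.2⟩
  rw [← card_filter_add_card_filter_not (s := tailAvoiders k (q + 1) (n + 1)) (fun π => π p = 0)]
  exact congrArg₂ _ ((congrArg card hzero).trans (card_map _)) (congrArg card hne)

end TailAvoiders

section StripPaths

variable {k n r : ℕ}

/-- The number of paths with `n` steps `±1` from height `0` to height `r` in the strip of heights
`0, …, k`. -/
def stripPaths (k : ℕ) : ℕ → ℕ → ℕ
  | 0, r => if r = 0 then 1 else 0
  | n + 1, 0 => stripPaths k n 1
  | n + 1, r + 1 => if r + 1 ≤ k then stripPaths k n r + stripPaths k n (r + 2) else 0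

theorem stripPaths_succ_zero (k n : ℕ) : stripPaths k (n + 1) 0 = stripPaths k n 1 := by
  rw [stripPaths]

theorem stripPaths_succ_succ (h : r + 1 ≤ k) :
    stripPaths k (n + 1) (r + 1) = stripPaths k n r + stripPaths k n (r + 2) := by
  rw [stripPaths, if_pos h]

theorem stripPaths_eq_zero_of_lt (h : k < r) : stripPaths k n r = 0 := by
  obtain ⟨r, rfl⟩ : ∃ s, r = s + 1 := ⟨r - 1, by omega⟩
  cases n with
  | zero => rw [stripPaths, if_neg (Nat.succ_ne_zero r)]
  | succ n => rw [stripPaths, if_neg (by omega)]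

theorem exists_of_stripPaths_ne_zero (h : stripPaths k n r ≠ 0) : ∃ q, 2 * q + r = n := by
  induction n generalizing r with
  | zero =>
    rw [stripPaths, ite_ne_right_iff] at h
    exact ⟨0, by omega⟩
  | succ n ih =>
    rcases r with - | r
    · obtain ⟨q, hq⟩ := ih h
      exact ⟨q + 1, by omega⟩
    rw [stripPaths, ite_ne_right_iff] at h
    by_cases hr : stripPaths k n r = 0
    · obtain ⟨q, hq⟩ := ih (r := r + 2) (by omega)
      exact ⟨q + 1, by omega⟩
    · obtain ⟨q, hq⟩ := ih hr
      exact ⟨q, by omega⟩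

theorem card_tailAvoiders_eq_stripPaths (k q r : ℕ) :
    #(tailAvoiders k q (q + r)) = stripPaths k (2 * q + r) r := by
  suffices ∀ n q r, 2 * q + r = n → #(tailAvoiders k q (q + r)) = stripPaths k n r from
    this _ q r rfl
  intro n
  induction n with
  | zero =>
    intro q r h
    obtain ⟨rfl, rfl⟩ : q = 0 ∧ r = 0 := by omega
    exact card_tailAvoiders_zero (Nat.zero_le k)
  | succ n ih =>
    intro q r h
    rcases lt_or_ge k r with hk | hk
    · rw [card_tailAvoiders_eq_zero (by omega), stripPaths_eq_zero_of_lt hk]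
    rcases r with - | r
    · obtain ⟨q, rfl⟩ : ∃ q', q = q' + 1 := ⟨q - 1, by omega⟩
      rw [add_zero, tailAvoiders_succ_self, ih q 1 (by omega), stripPaths_succ_zero]
    rw [stripPaths_succ_succ hk]
    rcases q with - | q
    · have htop : stripPaths k n (r + 2) = 0 := by
        by_contra h0
        obtain ⟨q, hq⟩ := exists_of_stripPaths_ne_zero h0
        omega
      rw [htop, ← ih 0 r (by omega), zero_add, zero_add, card_tailAvoiders_zero hk,
        card_tailAvoiders_zero (by omega)]
    · rw [← add_assoc, card_tailAvoiders_succ_succ (by omega) (by omega),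
        ih (q + 1) r (by omega), ← ih q (r + 2) (by omega),
        show q + (r + 2) = q + 1 + r + 1 by omega]

theorem sum_stripPaths_succ_mul (k n : ℕ) (f : ℕ → ℕ) :
    ∑ r ∈ range (k + 1), stripPaths k (n + 1) r * f r =
      ∑ r ∈ range k, (stripPaths k n r * f (r + 1) + stripPaths k n (r + 1) * f r) := by
  have hstep : ∑ r ∈ range k, stripPaths k (n + 1) (r + 1) * f (r + 1) =
      ∑ r ∈ range k, (stripPaths k n r * f (r + 1) + stripPaths k n (r + 2) * f (r + 1)) :=
    sum_congr rfl fun r hr => by rw [stripPaths_succ_succ (mem_range.1 hr), add_mul]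
  have hshift := sum_range_succ' (fun r => stripPaths k n (r + 1) * f r) k
  rw [sum_range_succ, stripPaths_eq_zero_of_lt (Nat.lt_succ_self k), zero_mul, add_zero] at hshift
  rw [sum_range_succ', stripPaths_succ_zero, hstep, sum_add_distrib, sum_add_distrib, hshift,
    zero_add, add_assoc]

/-- The transfer matrix of the strip is symmetric, so steps can be moved from one path to the
other. -/
theorem sum_stripPaths_mul_stripPaths (k a b : ℕ) :
    ∑ r ∈ range (k + 1), stripPaths k a r * stripPaths k b r = stripPaths k (a + b) 0 := by
  induction a generalizing b with
  | zero =>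
    rw [sum_eq_single_of_mem 0 (mem_range.2 k.succ_pos) fun r _ hr => by
      rw [stripPaths, if_neg hr, zero_mul], stripPaths, if_pos rfl, one_mul, zero_add]
  | succ a ih =>
    rw [Nat.add_right_comm, add_assoc, ← ih (b + 1), sum_stripPaths_succ_mul]
    simp only [mul_comm (stripPaths k a _) (stripPaths k (b + 1) _)]
    rw [sum_stripPaths_succ_mul]
    exact sum_congr rfl fun r _ => by ring

theorem card_avoiders (k n : ℕ) :
    #(avoiders {pattern132, increasing (k + 1)} n) =
      ∑ r ∈ range (k + 1), stripPaths k n r ^ 2 := by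
  have htail : avoiders {pattern132, increasing (k + 1)} n = tailAvoiders k n n := by
    ext π
    rw [mem_avoiders_iff_isAvoider, mem_tailAvoiders]
    exact (and_iff_left fun (a : Fin n) (ha : n ≤ a.val) => absurd a.2 ha.not_gt).symm
  simp only [htail, sq]
  rw [sum_stripPaths_mul_stripPaths, ← two_mul]
  exact card_tailAvoiders_eq_stripPaths k n 0

end StripPaths

section Chebyshev

open PowerSeries (X)

variable {k l r : ℕ}

/-- The generating function of the paths in the strip that end at height `r`. -/
noncomputable def stripSeries (k r : ℕ) : PowerSeries ℚ := .mk fun n => stripPaths k n r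

theorem coeff_stripSeries (k n r : ℕ) : (stripSeries k r).coeff n = stripPaths k n r := by
  rw [stripSeries, PowerSeries.coeff_mk]

theorem stripSeries_zero (k : ℕ) : stripSeries k 0 = 1 + X * stripSeries k 1 := by
  ext n
  cases n with
  | zero => simp [coeff_stripSeries, stripPaths]
  | succ n => simp [coeff_stripSeries, PowerSeries.coeff_succ_X_mul, PowerSeries.coeff_one,
      stripPaths_succ_zero]

theorem stripSeries_succ (h : r + 1 ≤ k) :
    stripSeries k (r + 1) = X * (stripSeries k r + stripSeries k (r + 2)) := by
  ext n
  cases n with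
  | zero => simp [coeff_stripSeries, stripPaths]
  | succ n => simp [coeff_stripSeries, PowerSeries.coeff_succ_X_mul, stripPaths_succ_succ h]

theorem stripSeries_eq_zero (h : k < r) : stripSeries k r = 0 := by
  ext n
  rw [coeff_stripSeries, stripPaths_eq_zero_of_lt h, Nat.cast_zero, map_zero]

theorem zL_ne_zero : zL ≠ 0 := HahnSeries.single_ne_zero one_ne_zero

theorem zL_mul_two_mul_inv : zL * (2 * (1 / (2 * zL))) = 1 := by
  have := algebraRat.charZero (LaurentSeries ℚ)
  have hz := zL_ne_zero
  field_simp

theorem UL_zero : UL 0 = 1 := by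
  rw [UL, Nat.cast_zero, Polynomial.Chebyshev.U_zero, map_one]

theorem zL_mul_UL_one : zL * UL 1 = 1 := by
  rw [UL, Nat.cast_one, Polynomial.Chebyshev.U_one, map_mul, Polynomial.aeval_X, map_ofNat,
    zL_mul_two_mul_inv]

theorem zL_mul_UL_add_two (m : ℕ) : zL * UL (m + 2) = UL (m + 1) - zL * UL m := by
  simp only [UL, Nat.cast_add, Nat.cast_ofNat, Nat.cast_one, Polynomial.Chebyshev.U_add_two,
    map_sub, map_mul, Polynomial.aeval_X, map_ofNat]
  rw [mul_sub, ← mul_assoc, zL_mul_two_mul_inv, one_mul]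

/-- `stripSeries` in the field of Laurent series, where `UL` lives. -/
noncomputable def stripLaurent (k r : ℕ) : LaurentSeries ℚ :=
  HahnSeries.ofPowerSeries ℤ ℚ (stripSeries k r)

theorem stripLaurent_zero (k : ℕ) : stripLaurent k 0 = 1 + zL * stripLaurent k 1 := by
  rw [stripLaurent, stripSeries_zero, map_add, map_mul, HahnSeries.ofPowerSeries_X, map_one,
    stripLaurent, zL]

theorem stripLaurent_succ (h : r + 1 ≤ k) :
    stripLaurent k (r + 1) = zL * (stripLaurent k r + stripLaurent k (r + 2)) := by
  rw [stripLaurent, stripSeries_succ h, map_mul, HahnSeries.ofPowerSeries_X, map_add,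
    stripLaurent, stripLaurent, zL]

theorem stripLaurent_eq_zero (h : k < r) : stripLaurent k r = 0 := by
  rw [stripLaurent, stripSeries_eq_zero h, map_zero]

theorem stripLaurent_eq_UL_mul (h : l + r = k) :
    stripLaurent k r = UL l * stripLaurent k k := by
  induction l using Nat.strong_induction_on generalizing r with
  | _ l ih =>
    match l with
    | 0 =>
      obtain rfl : r = k := by omega
      rw [UL_zero, one_mul]
    | 1 =>
      have hsucc := stripLaurent_succ (k := k) (r := r) (by omega)
      rw [stripLaurent_eq_zero (show k < r + 2 by omega), add_zero,
        show r + 1 = k by omega] at hsucc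
      linear_combination (-stripLaurent k r) * zL_mul_UL_one - UL 1 * hsucc
    | l + 2 =>
      have hsucc := stripLaurent_succ (k := k) (r := r) (by omega)
      rw [ih l (by omega) (show l + (r + 2) = k by omega),
        ih (l + 1) (by omega) (show l + 1 + (r + 1) = k by omega)] at hsucc
      apply mul_left_cancel₀ zL_ne_zero
      linear_combination -hsucc - stripLaurent k k * zL_mul_UL_add_two l

theorem zL_mul_UL_mul_stripLaurent (k : ℕ) : zL * UL (k + 1) * stripLaurent k k = 1 := by
  have hzero := stripLaurent_zero k
  cases k with
  | zero =>
    rw [stripLaurent_eq_zero zero_lt_one, mul_zero, add_zero] at hzero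
    rw [hzero, mul_one, zero_add, zL_mul_UL_one]
  | succ k =>
    rw [stripLaurent_eq_UL_mul (add_zero (k + 1)), stripLaurent_eq_UL_mul rfl] at hzero
    linear_combination hzero + stripLaurent (k + 1) (k + 1) * zL_mul_UL_add_two k

theorem UL_succ_ne_zero (k : ℕ) : UL (k + 1) ≠ 0 :=
  right_ne_zero_of_mul (left_ne_zero_of_mul_eq_one (zL_mul_UL_mul_stripLaurent k))

theorem Gtilde_eq_stripLaurent (h : l + r = k) : Gtilde k l = stripLaurent k r := by
  rw [Gtilde, stripLaurent_eq_UL_mul h, div_eq_iff (mul_ne_zero zL_ne_zero (UL_succ_ne_zero k))]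
  linear_combination (-UL l) * zL_mul_UL_mul_stripLaurent k

theorem g_eq_stripPaths (h : l + r = k) (n : ℕ) : g k l n = stripPaths k n r := by
  rw [g, Gtilde_eq_stripLaurent h, stripLaurent, HahnSeries.ofPowerSeries_apply_coeff,
    coeff_stripSeries]

theorem ofPowerSeries_mk_g (h : l ≤ k) :
    HahnSeries.ofPowerSeries ℤ ℚ (.mk (g k l)) = UL l / (zL * UL (k + 1)) := by
  obtain ⟨r, rfl⟩ := Nat.exists_eq_add_of_le h
  rw [← Gtilde, Gtilde_eq_stripLaurent rfl, stripLaurent, stripSeries]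
  congr 2
  exact funext (g_eq_stripPaths rfl)

theorem coeff_G (h : l + r = k) (n : ℕ) :
    (G k l).coeff n = (stripPaths k n r : Polynomial ℚ) ^ 2 := by
  rw [G, PowerSeries.coeff_mk, g_eq_stripPaths h, map_pow, map_natCast]

end Chebyshev

section Glue

variable {q m r k : ℕ}

/-- The positions of the first of the three blocks of sizes `q`, `m` and `q + r`. -/
def low : Fin q ↪o Fin (q + m + (q + r)) :=
  (Fin.castAddOrderEmb m).trans (Fin.castAddOrderEmb (q + r))

/-- The positions of the second of the three blocks of sizes `q`, `m` and `q + r`. -/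
def mid : Fin m ↪o Fin (q + m + (q + r)) :=
  (Fin.natAddOrderEmb q).trans (Fin.castAddOrderEmb (q + r))

/-- The positions of the third of the three blocks of sizes `q`, `m` and `q + r`. -/
def high : Fin (q + r) ↪o Fin (q + m + (q + r)) := Fin.natAddOrderEmb (q + m)

@[simp]
theorem val_low (l : Fin q) : (low l : Fin (q + m + (q + r))).val = l := rfl

@[simp]
theorem val_mid (a : Fin m) : (mid a : Fin (q + m + (q + r))).val = q + a := rfl

@[simp]
theorem val_high (u : Fin (q + r)) : (high u : Fin (q + m + (q + r))).val = q + m + u := rfl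

theorem low_lt_mid (l : Fin q) (a : Fin m) : (low l : Fin (q + m + (q + r))) < mid a := by
  rw [Fin.lt_def, val_low, val_mid]
  omega

theorem mid_lt_high (a : Fin m) (u : Fin (q + r)) : (mid a : Fin (q + m + (q + r))) < high u := by
  rw [Fin.lt_def, val_mid, val_high]
  omega

theorem low_lt_high (l : Fin q) (u : Fin (q + r)) :
    (low l : Fin (q + m + (q + r))) < high u := by
  rw [Fin.lt_def, val_low, val_high]
  omega

theorem eq_low_or_mid_or_high (t : Fin (q + m + (q + r))) :
    (∃ l, t = low l) ∨ (∃ a, t = mid a) ∨ ∃ u, t = high u := by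
  induction t using Fin.addCases with
  | left t =>
    induction t using Fin.addCases with
    | left l => exact Or.inl ⟨l, rfl⟩
    | right a => exact Or.inr (Or.inl ⟨a, rfl⟩)
  | right u => exact Or.inr (Or.inr ⟨u, rfl⟩)

/-- The positions in `glue β γ α` of the points above the middle block, listed from left to right
if `γ` is increasing on its last `r` positions. -/
def abovePos (γ : Perm (Fin (q + r))) : Fin (q + r) → Fin (q + m + (q + r)) :=
  Fin.append low fun d => high (γ (Fin.natAdd q d))

@[simp]
theorem abovePos_castAdd (γ : Perm (Fin (q + r))) (l : Fin q) :
    (abovePos γ (Fin.castAdd r l) : Fin (q + m + (q + r))) = low l :=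
  Fin.append_left _ _ l

@[simp]
theorem abovePos_natAdd (γ : Perm (Fin (q + r))) (d : Fin r) :
    (abovePos γ (Fin.natAdd q d) : Fin (q + m + (q + r))) = high (γ (Fin.natAdd q d)) :=
  Fin.append_right _ _ d

theorem strictMono_abovePos {γ : Perm (Fin (q + r))} (hγ : StrictMonoOn γ {t | q ≤ t.val}) :
    StrictMono (abovePos γ : Fin (q + r) → Fin (q + m + (q + r))) := by
  have htail : ∀ d : Fin r, q ≤ (Fin.natAdd q d).val := fun d => Nat.le_add_right q d
  refine Fin.addCases (fun l => ?_) (fun d => ?_) <;>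
    refine Fin.addCases (fun l' hlt => ?_) (fun d' hlt => ?_)
  · rw [abovePos_castAdd, abovePos_castAdd, low.lt_iff_lt]
    exact hlt
  · rw [abovePos_castAdd, abovePos_natAdd]
    exact low_lt_high _ _
  · exact absurd (Fin.lt_def.1 hlt) (l'.2.trans_le (htail d)).not_gt
  · rw [abovePos_natAdd, abovePos_natAdd, high.lt_iff_lt]
    exact hγ (htail d) (htail d') hlt

/-- The function underlying `glue`. -/
def glueFun (β γ : Perm (Fin (q + r))) (α : Perm (Fin m)) :
    Fin (q + m + (q + r)) → Fin (q + m + (q + r)) :=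
  Fin.append (Fin.append (fun l => high (β (Fin.castAdd r l))) fun a => mid (α a))
    fun u => abovePos β (γ.symm u)

section Apply

variable (β γ : Perm (Fin (q + r))) (α : Perm (Fin m))

theorem glueFun_low (l : Fin q) : glueFun β γ α (low l) = high (β (Fin.castAdd r l)) :=
  (Fin.append_left _ _ (Fin.castAdd m l)).trans (Fin.append_left _ _ l)

theorem glueFun_mid (a : Fin m) : glueFun β γ α (mid a) = mid (α a) :=
  (Fin.append_left _ _ (Fin.natAdd q a)).trans (Fin.append_right _ _ a)

theorem glueFun_high (u : Fin (q + r)) : glueFun β γ α (high u) = abovePos β (γ.symm u) :=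
  Fin.append_right _ _ u

theorem glueFun_abovePos (u : Fin (q + r)) : glueFun β γ α (abovePos γ u) = high (β u) := by
  refine Fin.addCases (fun l => ?_) (fun d => ?_) u
  · rw [abovePos_castAdd, glueFun_low]
  · rw [abovePos_natAdd, glueFun_high, Equiv.symm_apply_apply, abovePos_natAdd]

theorem leftInverse_glueFun : Function.LeftInverse (glueFun γ β α.symm) (glueFun β γ α) := by
  intro t
  rcases eq_low_or_mid_or_high t with ⟨l, rfl⟩ | ⟨a, rfl⟩ | ⟨u, rfl⟩
  · rw [glueFun_low, glueFun_high, Equiv.symm_apply_apply, abovePos_castAdd]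
  · rw [glueFun_mid, glueFun_mid, Equiv.symm_apply_apply]
  · rw [glueFun_high, glueFun_abovePos, Equiv.apply_symm_apply]

/-- The permutation with the block `α` on `[q, q + m)` in which the points above this block have
the pattern `β` and the points to the right of it have the pattern `γ⁻¹`. Both patterns contain the
`r` points above and to the right of the block; these have the last `r` positions in `β` and the
last `r` values in `γ⁻¹`. -/
def glue : Perm (Fin (q + m + (q + r))) where
  toFun := glueFun β γ α
  invFun := glueFun γ β α.symm
  left_inv := leftInverse_glueFun β γ α
  right_inv := leftInverse_glueFun γ β α.symm

theorem glue_symm : (glue β γ α).symm = glue γ β α.symm := by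
  ext1 t
  rfl

theorem glue_low (l : Fin q) : glue β γ α (low l) = high (β (Fin.castAdd r l)) :=
  glueFun_low β γ α l

theorem glue_mid (a : Fin m) : glue β γ α (mid a) = mid (α a) := glueFun_mid β γ α a

theorem glue_abovePos (u : Fin (q + r)) : glue β γ α (abovePos γ u) = high (β u) :=
  glueFun_abovePos β γ α u

theorem glue_high (u : Fin (q + r)) : glue β γ α (high (γ u)) = abovePos β u :=
  (glueFun_high β γ α (γ u)).trans (by rw [Equiv.symm_apply_apply])

theorem glue_high_left (l : Fin q) : glue β γ α (high (γ (Fin.castAdd r l))) = low l := by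
  rw [glue_high, abovePos_castAdd]

theorem glue_high_right (d : Fin r) :
    glue β γ α (high (γ (Fin.natAdd q d))) = high (β (Fin.natAdd q d)) := by
  rw [glue_high, abovePos_natAdd]

end Apply

theorem glue_cases (γ : Perm (Fin (q + r))) (t : Fin (q + m + (q + r))) :
    (∃ l, t = low l) ∨ (∃ a, t = mid a) ∨ (∃ l, t = high (γ (Fin.castAdd r l))) ∨
      ∃ d, t = high (γ (Fin.natAdd q d)) := by
  rcases eq_low_or_mid_or_high t with h | h | ⟨u, rfl⟩
  · exact Or.inl h
  · exact Or.inr (Or.inl h)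
  · obtain ⟨v, rfl⟩ := γ.surjective u
    refine Fin.addCases (fun l => ?_) (fun d => ?_) v
    · exact Or.inr (Or.inr (Or.inl ⟨l, rfl⟩))
    · exact Or.inr (Or.inr (Or.inr ⟨d, rfl⟩))

section Avoider

variable {β γ : Perm (Fin (q + r))} {α : Perm (Fin m)}

theorem mem_range_abovePos_of_high_le {u : Fin (q + r)} {t : Fin (q + m + (q + r))}
    (h : high u ≤ glue β γ α t) : t ∈ Set.range (abovePos γ) := by
  rcases glue_cases γ t with ⟨l, rfl⟩ | ⟨a, rfl⟩ | ⟨l, rfl⟩ | ⟨d, rfl⟩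
  · exact ⟨Fin.castAdd r l, abovePos_castAdd γ l⟩
  · exact absurd (glue_mid β γ α a ▸ h) (mid_lt_high _ _).not_ge
  · exact absurd (glue_high_left β γ α l ▸ h) (low_lt_high _ _).not_ge
  · exact ⟨Fin.natAdd q d, abovePos_natAdd γ d⟩

theorem northEastChain_glue_abovePos_iff (hγ : StrictMonoOn γ {t | q ≤ t.val})
    {u : Fin (q + r)} :
    NorthEastChain k (glue β γ α) (abovePos γ u) ↔ NorthEastChain k β u := by
  refine northEastChain_map_iff (e := OrderEmbedding.ofStrictMono _ (strictMono_abovePos hγ))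
    (fun u v => ?_) fun t ht => ?_
  · simp only [OrderEmbedding.coe_ofStrictMono, glue_abovePos, high.lt_iff_lt]
  · have hle := (mem_northEast.1 ht).2
    rw [OrderEmbedding.coe_ofStrictMono, glue_abovePos] at hle
    exact mem_range_abovePos_of_high_le hle

theorem northEastChain_glue_mid_iff (hβ : StrictMonoOn β {t | q ≤ t.val})
    (hγ : StrictMonoOn γ {t | q ≤ t.val}) {a : Fin m} :
    NorthEastChain (k + r) (glue β γ α) (mid a) ↔ NorthEastChain k α a := by
  let diag : Fin r ↪o Fin (q + m + (q + r)) :=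
    (Fin.natAddOrderEmb q).trans (OrderEmbedding.ofStrictMono (abovePos γ) (strictMono_abovePos hγ))
  have hdiag : ∀ d, diag d = high (γ (Fin.natAdd q d)) := abovePos_natAdd γ
  have hcard : #(univ.map diag.toEmbedding) = r := by rw [card_map, card_univ, Fintype.card_fin]
  have key := northEastChain_add_card_iff (k := k) (σ := α) (π := glue β γ α) (e := mid) (a := a)
    (T := univ.map diag.toEmbedding) ?_ ?_ ?_ ?_
  · rwa [hcard] at key
  · intro a b
    rw [glue_mid, glue_mid, mid.lt_iff_lt]
  · intro x hx y hy hxy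
    obtain ⟨d, -, rfl⟩ := mem_map.1 hx
    obtain ⟨d', -, rfl⟩ := mem_map.1 hy
    simp only [RelEmbedding.coe_toEmbedding, diag.lt_iff_lt] at hxy
    simp only [RelEmbedding.coe_toEmbedding, hdiag, glue_high_right, high.lt_iff_lt]
    exact hβ (Nat.le_add_right q d) (Nat.le_add_right q d') ((Fin.natAdd_lt_natAdd_iff q).2 hxy)
  · intro b t ht
    obtain ⟨d, -, rfl⟩ := mem_map.1 ht
    rw [RelEmbedding.coe_toEmbedding, hdiag, glue_mid, glue_high_right]
    exact ⟨mid_lt_high _ _, mid_lt_high _ _⟩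
  · intro t ht
    obtain ⟨hat, hle⟩ := mem_northEast.1 ht
    rcases glue_cases γ t with ⟨l, rfl⟩ | ⟨b, rfl⟩ | ⟨l, rfl⟩ | ⟨d, rfl⟩
    · exact absurd hat (low_lt_mid _ _).not_ge
    · exact Or.inl ⟨b, rfl⟩
    · rw [glue_mid, glue_high_left] at hle
      exact absurd hle (low_lt_mid _ _).not_ge
    · exact Or.inr (mem_map.2 ⟨d, mem_univ d, hdiag d⟩)

theorem isAvoider_glue_iff (hβ : StrictMonoOn β {t | q ≤ t.val})
    (hγ : StrictMonoOn γ {t | q ≤ t.val}) :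
    IsAvoider (k + r) (glue β γ α) ↔
      IsAvoider (k + r) β ∧ IsAvoider (k + r) γ ∧ IsAvoider k α := by
  have hright : ∀ u, NorthEastChain (k + r) (glue β γ α) (high (γ u)) ↔
      NorthEastChain (k + r) γ u := fun u => by
    rw [← northEastChain_symm_iff, glue_high, glue_symm, northEastChain_glue_abovePos_iff hβ]
  refine ⟨fun h => ⟨fun u => (northEastChain_glue_abovePos_iff hγ).1 (h _), fun u =>
    (hright u).1 (h _), fun a => (northEastChain_glue_mid_iff hβ hγ).1 (h _)⟩, ?_⟩
  rintro ⟨hβk, hγk, hαk⟩ t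
  rcases eq_low_or_mid_or_high t with ⟨l, rfl⟩ | ⟨a, rfl⟩ | ⟨u, rfl⟩
  · rw [← abovePos_castAdd γ]
    exact (northEastChain_glue_abovePos_iff hγ).2 (hβk _)
  · exact (northEastChain_glue_mid_iff hβ hγ).2 (hαk a)
  · obtain ⟨v, rfl⟩ := γ.surjective u
    exact (hright v).2 (hγk v)

end Avoider

/-- The shape of the permutations of the form `glue β γ α`: the block `[q, q + m)` is mapped to
itself, everything before it is mapped above it, and the points above and to the right of it form
an increasing sequence. -/
def Corner {n : ℕ} (q m : ℕ) (π : Perm (Fin n)) : Prop :=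
  (∀ t, t.val < q → q + m ≤ (π t).val) ∧
  (∀ t, (q ≤ t.val ∧ t.val < q + m) ↔ (q ≤ (π t).val ∧ (π t).val < q + m)) ∧
  StrictMonoOn π {t | q + m ≤ t.val ∧ q + m ≤ (π t).val}

theorem Corner.symm {n : ℕ} {π : Perm (Fin n)} (h : Corner q m π) : Corner q m π.symm := by
  obtain ⟨hlow, hmid, hhigh⟩ := h
  refine ⟨fun v hv => ?_, fun v => ?_, fun v hv w hw hvw => ?_⟩
  · have hlow := hlow (π.symm v)
    have hmid := hmid (π.symm v)
    rw [π.apply_symm_apply] at hlow hmid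
    omega
  · simpa only [π.apply_symm_apply] using (hmid (π.symm v)).symm
  · refine (hhigh.lt_iff_lt (a := π.symm v) (b := π.symm w) ?_ ?_).1 ?_
    · simpa only [Set.mem_ofPred_eq, π.apply_symm_apply] using hv.symm
    · simpa only [Set.mem_ofPred_eq, π.apply_symm_apply] using hw.symm
    · simpa only [π.apply_symm_apply] using hvw

theorem corner_glue {β γ : Perm (Fin (q + r))} (α : Perm (Fin m))
    (hβ : StrictMonoOn β {t | q ≤ t.val}) (hγ : StrictMonoOn γ {t | q ≤ t.val}) :
    Corner q m (glue β γ α) := by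
  refine ⟨fun t ht => ?_, fun t => ?_, ?_⟩
  · rcases eq_low_or_mid_or_high t with ⟨l, rfl⟩ | ⟨a, rfl⟩ | ⟨u, rfl⟩
    · rw [glue_low, val_high]
      omega
    · rw [val_mid] at ht
      omega
    · rw [val_high] at ht
      omega
  · rcases glue_cases γ t with ⟨l, rfl⟩ | ⟨a, rfl⟩ | ⟨l, rfl⟩ | ⟨d, rfl⟩ <;>
      simp only [glue_low, glue_mid, glue_high_left, glue_high_right, val_low, val_mid,
        val_high] <;>
      omega
  · have hdiag : ∀ t ∈ {t | q + m ≤ t.val ∧ q + m ≤ (glue β γ α t).val},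
        ∃ d, t = high (γ (Fin.natAdd q d)) := by
      rintro t ⟨ht, hπt⟩
      rcases glue_cases γ t with ⟨l, rfl⟩ | ⟨a, rfl⟩ | ⟨l, rfl⟩ | hd
      · rw [val_low] at ht
        omega
      · rw [val_mid] at ht
        omega
      · rw [glue_high_left, val_low] at hπt
        omega
      · exact hd
    intro t ht t' ht' htt'
    obtain ⟨d, rfl⟩ := hdiag t ht
    obtain ⟨d', rfl⟩ := hdiag t' ht'
    have hd : q ≤ (Fin.natAdd q d).val := Nat.le_add_right q d
    have hd' : q ≤ (Fin.natAdd q d').val := Nat.le_add_right q d'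
    rw [high.lt_iff_lt, hγ.lt_iff_lt hd hd'] at htt'
    rw [glue_high_right, glue_high_right, high.lt_iff_lt]
    exact hβ hd hd' htt'

theorem perm_eq_of_castAdd_eq {β β' : Perm (Fin (q + r))}
    (hβ : StrictMonoOn β {t | q ≤ t.val}) (hβ' : StrictMonoOn β' {t | q ≤ t.val})
    (h : ∀ l, β (Fin.castAdd r l) = β' (Fin.castAdd r l)) : β = β' :=
  perm_eq_of_strictMonoOn hβ hβ' fun t ht => h (t.castLT (not_le.1 ht))

theorem exists_perm_castAdd_eq {f : Fin q → Fin (q + r)} (hf : Function.Injective f) :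
    ∃ β : Perm (Fin (q + r)), StrictMonoOn β {t | q ≤ t.val} ∧ ∀ l, β (Fin.castAdd r l) = f l := by
  have hcard : #(univ.image f)ᶜ = r := by
    rw [card_compl, card_image_of_injective _ hf, card_univ, Fintype.card_fin, Fintype.card_fin,
      Nat.add_sub_cancel_left]
  have hinj : Function.Injective (Fin.append f ((univ.image f)ᶜ.orderEmbOfFin hcard)) := by
    rw [Fin.append_injective_iff]
    refine ⟨hf, (orderEmbOfFin _ hcard).injective, fun l d heq => ?_⟩
    have hmem := orderEmbOfFin_mem _ hcard d
    rw [← heq, mem_compl] at hmem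
    exact hmem (mem_image_of_mem f (mem_univ l))
  refine ⟨.ofBijective _ (Finite.injective_iff_bijective.1 hinj), ?_, fun l => ?_⟩
  · refine Fin.addCases (fun l hl => ?_) (fun d _ => ?_)
    · exact absurd l.2 (not_lt.2 hl)
    refine Fin.addCases (fun l hl => ?_) (fun d' _ hdd' => ?_)
    · exact absurd l.2 (not_lt.2 hl)
    simpa only [Equiv.ofBijective_apply, Fin.append_right, OrderEmbedding.lt_iff_lt] using
      (Fin.natAdd_lt_natAdd_iff q).1 hdd'
  · rw [Equiv.ofBijective_apply, Fin.append_left]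

theorem glue_injective {β γ β' γ' : Perm (Fin (q + r))} {α α' : Perm (Fin m)}
    (hβ : StrictMonoOn β {t | q ≤ t.val}) (hγ : StrictMonoOn γ {t | q ≤ t.val})
    (hβ' : StrictMonoOn β' {t | q ≤ t.val}) (hγ' : StrictMonoOn γ' {t | q ≤ t.val})
    (h : glue β γ α = glue β' γ' α') : β = β' ∧ γ = γ' ∧ α = α' := by
  have hleft : ∀ {β γ β' γ' : Perm (Fin (q + r))} {α α' : Perm (Fin m)},
      glue β γ α = glue β' γ' α' → ∀ l, β (Fin.castAdd r l) = β' (Fin.castAdd r l) := by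
    intro β γ β' γ' α α' h l
    have hl := congrArg (fun π : Perm _ => π (low l)) h
    simpa only [glue_low, high.eq_iff_eq] using hl
  have hsymm : glue γ β α.symm = glue γ' β' α'.symm := by rw [← glue_symm, ← glue_symm, h]
  refine ⟨perm_eq_of_castAdd_eq hβ hβ' (hleft h), perm_eq_of_castAdd_eq hγ hγ' (hleft hsymm), ?_⟩
  ext1 a
  have ha := congrArg (fun π : Perm _ => π (mid a)) h
  simpa only [glue_mid, mid.eq_iff_eq] using ha

section Corner

variable {π : Perm (Fin (q + m + (q + r)))}

theorem Corner.exists_left_pattern (h : Corner q m π) :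
    ∃ β : Perm (Fin (q + r)), StrictMonoOn β {t | q ≤ t.val} ∧
      ∀ l, π (low l) = high (β (Fin.castAdd r l)) := by
  have hhigh : ∀ l, ∃ u, π (low l) = high u := fun l => by
    have hge := h.1 (low l) l.2
    rcases eq_low_or_mid_or_high (π (low l)) with ⟨l', hl'⟩ | ⟨a, ha⟩ | hu
    · rw [hl', val_low] at hge
      omega
    · rw [ha, val_mid] at hge
      omega
    · exact hu
  choose f hf using hhigh
  have hinj : Function.Injective f := fun l l' hll' => by
    have hπ : π (low l) = π (low l') := by rw [hf, hf, hll']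
    exact low.injective (π.injective hπ)
  obtain ⟨β, hβ, hβf⟩ := exists_perm_castAdd_eq hinj
  exact ⟨β, hβ, fun l => by rw [hf, hβf]⟩

theorem Corner.exists_mid_pattern (h : Corner q m π) :
    ∃ α : Perm (Fin m), ∀ a, π (mid a) = mid (α a) := by
  have hmid : ∀ a, ∃ b, π (mid a) = mid b := fun a => by
    have hmem := (h.2.1 (mid a)).1 ⟨Nat.le_add_right q a, Nat.add_lt_add_left a.2 q⟩
    rcases eq_low_or_mid_or_high (π (mid a)) with ⟨l, hl⟩ | hb | ⟨u, hu⟩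
    · rw [hl, val_low] at hmem
      omega
    · exact hb
    · rw [hu, val_high] at hmem
      omega
  choose f hf using hmid
  have hinj : Function.Injective f := fun a b hab => by
    have hπ : π (mid a) = π (mid b) := by rw [hf, hf, hab]
    exact mid.injective (π.injective hπ)
  exact ⟨.ofBijective f (Finite.injective_iff_bijective.1 hinj), hf⟩

theorem Corner.le_apply_high (h : Corner q m π) {γ : Perm (Fin (q + r))}
    (hγ : ∀ l, π.symm (low l) = high (γ (Fin.castAdd r l))) (d : Fin r) :
    q + m ≤ (π (high (γ (Fin.natAdd q d)))).val := by
  rcases eq_low_or_mid_or_high (π (high (γ (Fin.natAdd q d)))) with ⟨l, hl⟩ | ⟨a, ha⟩ | ⟨u, hu⟩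
  · rw [← Equiv.eq_symm_apply, hγ, high.eq_iff_eq, γ.apply_eq_iff_eq, Fin.ext_iff,
      Fin.val_natAdd, Fin.val_castAdd] at hl
    omega
  · have hmid := (h.2.1 (high (γ (Fin.natAdd q d)))).2
    rw [ha, val_mid, val_high] at hmid
    omega
  · rw [hu, val_high]
    omega

theorem Corner.exists_eq_glue (h : Corner q m π) :
    ∃ (β γ : Perm (Fin (q + r))) (α : Perm (Fin m)), StrictMonoOn β {t | q ≤ t.val} ∧
      StrictMonoOn γ {t | q ≤ t.val} ∧ π = glue β γ α := by
  obtain ⟨β, hβ, hπlow⟩ := h.exists_left_pattern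
  obtain ⟨γ, hγ, hπsymm⟩ := h.symm.exists_left_pattern
  obtain ⟨α, hπmid⟩ := h.exists_mid_pattern
  have hdiag : Set.range (fun d => high (γ (Fin.natAdd q d))) ⊆
      {t | q + m ≤ t.val ∧ q + m ≤ (π t).val} := by
    rintro _ ⟨d, rfl⟩
    exact ⟨Nat.le_add_right _ _, h.le_apply_high hπsymm d⟩
  have hdiag' : Set.range (fun d => high (γ (Fin.natAdd q d))) ⊆
      {t | q + m ≤ t.val ∧ q + m ≤ (glue β γ α t).val} := by
    rintro _ ⟨d, rfl⟩
    exact ⟨Nat.le_add_right _ _, by rw [glue_high_right]; exact Nat.le_add_right _ _⟩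
  refine ⟨β, γ, α, hβ, hγ, perm_eq_of_strictMonoOn (h.2.2.mono hdiag)
    ((corner_glue α hβ hγ).2.2.mono hdiag') fun t ht => ?_⟩
  rcases glue_cases γ t with ⟨l, rfl⟩ | ⟨a, rfl⟩ | ⟨l, rfl⟩ | ⟨d, rfl⟩
  · rw [hπlow, glue_low]
  · rw [hπmid, glue_mid]
  · rw [← hπsymm, Equiv.apply_symm_apply, hπsymm, glue_high_left]
  · exact absurd ⟨d, rfl⟩ ht

end Corner

end Glue

section Crossings

variable {n k q p r : ℕ} {π : Perm (Fin n)} {i : Fin n}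

/-- The positions before `i` with value at least `i`: the arcs `t → π t` passing from the left of
`i` to `i` or beyond. -/
def crossings (π : Perm (Fin n)) (i : Fin n) : Finset (Fin n) := {t | t < i ∧ i ≤ π t}

theorem mem_crossings {t : Fin n} : t ∈ crossings π i ↔ t < i ∧ i ≤ π t := by
  simp only [crossings, mem_filter_univ]

theorem card_crossings_le (π : Perm (Fin n)) (i : Fin n) : #(crossings π i) ≤ i := by
  rw [← Fin.card_Iio]
  exact card_le_card fun t ht => mem_Iio.2 (mem_crossings.1 ht).1

theorem card_crossings_add_card_northEast (hi : π i = i) :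
    i + #(crossings π i) + #(northEast π i) = n := by
  have hdisj : Disjoint (crossings π i) (northEast π i) := by
    rw [disjoint_left]
    exact fun t ht ht' => (mem_crossings.1 ht).1.not_ge (mem_northEast.1 ht').1
  have hunion : crossings π i ∪ northEast π i = (Ici i).map π.symm.toEmbedding := by
    ext t
    rw [mem_union, mem_crossings, mem_northEast, hi, ← or_and_right, mem_map_equiv, mem_Ici,
      Equiv.symm_symm]
    exact and_iff_right (lt_or_ge t i)
  have hcard := congrArg card hunion
  rw [card_union_of_disjoint hdisj, card_map, Fin.card_Ici] at hcard
  omega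

theorem card_crossings_symm (hi : π i = i) : #(crossings π.symm i) = #(crossings π i) := by
  have hi' : π.symm i = i := π.symm_apply_eq.2 hi.symm
  have hsymm := card_crossings_add_card_northEast hi'
  rw [← hi, northEast_symm, card_map, hi] at hsymm
  have := card_crossings_add_card_northEast hi
  omega

theorem mem_iff_val_lt_card_of_isLowerSet {s : Finset (Fin n)}
    (hs : IsLowerSet (s : Set (Fin n))) {t : Fin n} : t ∈ s ↔ t.val < #s := by
  constructor
  · intro ht
    have hsub : Iic t ⊆ s := fun t' ht' => hs (mem_Iic.1 ht') ht
    simpa only [Fin.card_Iic, Nat.succ_le_iff] using card_le_card hsub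
  · intro ht
    by_contra hts
    have hsub : s ⊆ Iio t := fun t' ht' =>
      mem_Iio.2 (lt_of_not_ge fun hle => hts (hs hle ht'))
    have hcard := card_le_card hsub
    rw [Fin.card_Iio] at hcard
    omega

theorem IsAvoider.isLowerSet_crossings (h : IsAvoider k π) (hi : π i = i) :
    IsLowerSet (crossings π i : Set (Fin n)) := by
  intro t t' ht' ht
  rw [mem_coe, mem_crossings] at ht ⊢
  refine ⟨ht'.trans_lt ht.1, le_of_not_gt fun hlt => ?_⟩
  -- otherwise `t' < t < i` is an occurrence of `132`
  have hmem : t ∈ northEast π t' := mem_northEast.2 ⟨ht', hlt.le.trans ht.2⟩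
  have hmem' : i ∈ northEast π t' := mem_northEast.2 ⟨ht'.trans ht.1.le, hlt.le.trans hi.ge⟩
  exact (((h t').1 hmem hmem' ht.1).trans_eq hi).not_ge ht.2

theorem IsAvoider.mem_crossings_iff (h : IsAvoider k π) (hi : π i = i) {t : Fin n} :
    t ∈ crossings π i ↔ t.val < #(crossings π i) :=
  mem_iff_val_lt_card_of_isLowerSet (h.isLowerSet_crossings hi)

theorem IsAvoider.apply_mem_Icc (h : IsAvoider k π) (hi : π i = i) {t : Fin n}
    (ht : #(crossings π i) ≤ t) (hti : t ≤ i) : #(crossings π i) ≤ π t ∧ π t ≤ i := by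
  have hi' : π.symm i = i := π.symm_apply_eq.2 hi.symm
  rcases hti.eq_or_lt with rfl | hti
  · rw [hi]
    exact ⟨ht, le_rfl⟩
  · have hπt : π t < i := lt_of_not_ge fun hle =>
      ht.not_gt ((h.mem_crossings_iff hi).1 (mem_crossings.2 ⟨hti, hle⟩))
    refine ⟨le_of_not_gt fun hlt => ?_, hπt.le⟩
    rw [← card_crossings_symm hi, ← h.symm.mem_crossings_iff hi', mem_crossings,
      Equiv.symm_apply_apply] at hlt
    exact hlt.2.not_gt hti

theorem IsAvoider.corner (h : IsAvoider k π) (hi : π i = i) (hp : #(crossings π i) + p = i) :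
    Corner #(crossings π i) (p + 1) π := by
  have hi' : π.symm i = i := π.symm_apply_eq.2 hi.symm
  refine ⟨fun t ht => ?_, fun t => ⟨fun ht => ?_, fun ht => ?_⟩, ?_⟩
  · obtain ⟨hti, hit⟩ := mem_crossings.1 ((h.mem_crossings_iff hi).2 ht)
    have hne : i ≠ π t := fun heq => hti.ne (π.injective (hi.trans heq)).symm
    rw [← add_assoc, hp]
    exact Fin.lt_def.1 (hit.lt_of_ne hne)
  · have := h.apply_mem_Icc hi ht.1 (Fin.le_def.2 (by omega))
    rw [Fin.le_def] at this
    omega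
  · have := h.symm.apply_mem_Icc hi' (t := π t) (by rw [card_crossings_symm hi]; exact ht.1)
      (Fin.le_def.2 (by omega))
    rw [Equiv.symm_apply_apply, card_crossings_symm hi, Fin.le_def] at this
    omega
  · refine (h i).1.mono fun t ht => mem_northEast.2 ?_
    have : (#(crossings π i) + (p + 1) ≤ t ∧ #(crossings π i) + (p + 1) ≤ π t) := ht
    rw [hi, Fin.le_def, Fin.le_def]
    omega

theorem Corner.card_crossings (h : Corner q (p + 1) π) (hi : π i = i) (hqp : i.val = q + p) :
    #(crossings π i) = q := by
  have hcross : crossings π i = ({t | t.val < q} : Finset (Fin n)) := by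
    ext t
    rw [mem_crossings, mem_filter_univ, Fin.lt_def, Fin.le_def]
    have hlow := h.1 t
    have hmid := h.2.1 t
    have hinj : (π t).val = i.val → t.val = i.val := fun heq =>
      congrArg Fin.val (π.injective ((Fin.ext heq).trans hi.symm))
    omega
  rw [hcross, Fin.card_filter_val_lt, min_eq_right]
  have := i.2
  omega

/-- The sizes `(r, (2 * q + r, p))` of the parts into which a permutation `π` with fixed point `i`
is cut at `i`: `q` is the number of arcs passing over `i`, `r` is the number of points above and to
the right of `i`, and `p = i - q`. -/
def cutSizes (π : Perm (Fin n)) (i : Fin n) : ℕ × ℕ × ℕ :=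
  (#(northEast π i) - 1, 2 * #(crossings π i) + (#(northEast π i) - 1), i - #(crossings π i))

theorem cutSizes_mem {π : Perm (Fin (n + 1))} {i : Fin (n + 1)} (h : IsAvoider k π)
    (hi : π i = i) : cutSizes π i ∈ range (k + 1) ×ˢ antidiagonal n := by
  have hpos := card_pos.2 ⟨i, self_mem_northEast π i⟩
  have hk := (h i).2
  have hle := card_crossings_le π i
  have hsum := card_crossings_add_card_northEast hi
  rw [cutSizes, mem_product, mem_range, HasAntidiagonal.mem_antidiagonal]
  dsimp only
  omega

theorem cutSizes_eq_iff (hn : q + (p + 1) + (q + r) = n) (h : IsAvoider k π) (hi : π i = i) :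
    cutSizes π i = (r, 2 * q + r, p) ↔ i.val = q + p ∧ Corner q (p + 1) π := by
  have hpos := card_pos.2 ⟨i, self_mem_northEast π i⟩
  have hle := card_crossings_le π i
  have hsum := card_crossings_add_card_northEast hi
  simp only [cutSizes, Prod.mk.injEq]
  constructor
  · rintro ⟨hr, hq, hp⟩
    obtain rfl : #(crossings π i) = q := by omega
    exact ⟨by omega, h.corner hi (by omega)⟩
  · rintro ⟨hqp, hcorner⟩
    have := hcorner.card_crossings hi hqp
    omega

end Crossings

section FixedPoints

variable {q m r k n : ℕ}

/-- The number of fixed points of `π` before `i`. -/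
def fpBelow (π : Perm (Fin n)) (i : Fin n) : ℕ := #{j | j < i ∧ π j = j}

theorem pow_card_eq_one_add {ι R : Type*} [LinearOrder ι] [CommRing R] (x : R) (s : Finset ι) :
    x ^ #s = 1 + (x - 1) * ∑ i ∈ s, x ^ #{j ∈ s | j < i} := by
  have hprod := prod_one_add_ordered s fun _ => x - 1
  simpa only [add_sub_cancel, prod_const, ← mul_sum] using hprod

theorem pow_fp_eq {R : Type*} [CommRing R] (x : R) (π : Perm (Fin n)) :
    x ^ fp π = 1 + (x - 1) * ∑ i with π i = i, x ^ fpBelow π i := by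
  rw [fp, pow_card_eq_one_add]
  simp only [fpBelow, filter_filter, and_comm]

theorem fpBelow_glue_mid (β γ : Perm (Fin (q + r))) (α : Perm (Fin m)) (a : Fin m) :
    fpBelow (glue β γ α) (mid a) = fpBelow α a := by
  have hmap : ({j | j < mid a ∧ glue β γ α j = j} : Finset (Fin (q + m + (q + r)))) =
      ({b | b < a ∧ α b = b} : Finset (Fin m)).map mid.toEmbedding := by
    ext j
    simp only [mem_filter_univ, mem_map, RelEmbedding.coe_toEmbedding]
    constructor
    · rintro ⟨hja, hj⟩
      rcases eq_low_or_mid_or_high j with ⟨l, rfl⟩ | ⟨b, rfl⟩ | ⟨u, rfl⟩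
      · exact absurd (glue_low β γ α l ▸ hj) (low_lt_high _ _).ne'
      · rw [glue_mid, mid.eq_iff_eq] at hj
        exact ⟨b, ⟨mid.lt_iff_lt.1 hja, hj⟩, rfl⟩
      · exact absurd hja (mid_lt_high _ _).not_gt
    · rintro ⟨b, ⟨hba, hb⟩, rfl⟩
      exact ⟨mid.lt_iff_lt.2 hba, by rw [glue_mid, hb]⟩
  rw [fpBelow, hmap, card_map, fpBelow]

theorem fpBelow_insertPoint_last (σ : Perm (Fin n)) :
    fpBelow (insertPoint (Fin.last n) (Fin.last n) σ) (Fin.last n) = fp σ := by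
  have hmap : ({j | j < Fin.last n ∧ insertPoint (Fin.last n) (Fin.last n) σ j = j} :
      Finset (Fin (n + 1))) = ({j | σ j = j} : Finset (Fin n)).map Fin.castSuccEmb := by
    ext j
    simp only [mem_filter_univ, mem_map, Fin.coe_castSuccEmb]
    rcases Fin.eq_self_or_eq_succAbove (Fin.last n) j with rfl | ⟨j, rfl⟩
    · simp only [lt_irrefl, false_and, false_iff, not_exists, not_and]
      exact fun j _ => (Fin.castSucc_lt_last j).ne
    · rw [insertPoint_succAbove, Fin.succAbove_last, Fin.castSucc_inj]
      refine ⟨fun h => ⟨j, h.2, rfl⟩, ?_⟩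
      rintro ⟨j', hj', heq⟩
      exact ⟨Fin.castSucc_lt_last j, Fin.castSucc_injective n heq ▸ hj'⟩
  rw [fpBelow, hmap, card_map, fp]

end FixedPoints

section Recurrence

variable {k n p q r a : ℕ}

open Classical in
/-- The permutations of length `n` avoiding `132` and `12⋯(k+1)`, with a marked fixed point. -/
noncomputable def pointedAvoiders (k n : ℕ) : Finset (Perm (Fin n) × Fin n) :=
  {y | IsAvoider k y.1 ∧ y.1 y.2 = y.2}

theorem mem_pointedAvoiders {y : Perm (Fin n) × Fin n} :
    y ∈ pointedAvoiders k n ↔ IsAvoider k y.1 ∧ y.1 y.2 = y.2 := by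
  simp only [pointedAvoiders, mem_filter_univ]

theorem sum_avoiders_pow_fp {R : Type*} [CommRing R] (x : R) (k n : ℕ) :
    ∑ π ∈ avoiders {pattern132, increasing (k + 1)} n, x ^ fp π =
      #(avoiders {pattern132, increasing (k + 1)} n) +
        (x - 1) * ∑ y ∈ pointedAvoiders k n, x ^ fpBelow y.1 y.2 := by
  have hpointed : ∑ y ∈ pointedAvoiders k n, x ^ fpBelow y.1 y.2 =
      ∑ π ∈ avoiders {pattern132, increasing (k + 1)} n, ∑ i with π i = i, x ^ fpBelow π i := by
    refine sum_finset_product' (f := fun π i => x ^ fpBelow π i) _ _ _ fun y => ?_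
    rw [mem_pointedAvoiders, mem_avoiders_iff_isAvoider, mem_filter_univ]
  simp only [pow_fp_eq x, sum_add_distrib, ← mul_sum, hpointed, sum_const, nsmul_one]

theorem sum_pointedAvoiders_last {R : Type*} [CommSemiring R] (x : R) (k p : ℕ) :
    ∑ y ∈ pointedAvoiders (k + 1) (p + 1) with y.2 = Fin.last p, x ^ fpBelow y.1 y.2 =
      ∑ σ ∈ avoiders {pattern132, increasing (k + 1)} p, x ^ fp σ := by
  symm
  refine sum_nbij (fun σ => (insertPoint (Fin.last p) (Fin.last p) σ, Fin.last p)) ?_ ?_ ?_ ?_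
  · intro σ hσ
    rw [mem_avoiders_iff_isAvoider] at hσ
    exact mem_filter.2 ⟨mem_pointedAvoiders.2
      ⟨isAvoider_insertPoint_last_iff.2 hσ, insertPoint_self _ _ _⟩, rfl⟩
  · exact fun σ _ τ _ h => insertPoint_injective _ _ (congrArg Prod.fst h)
  · rintro ⟨π, i⟩ hy
    simp only [mem_coe, mem_filter, mem_pointedAvoiders] at hy
    obtain ⟨⟨hπ, hlast⟩, rfl⟩ := hy
    obtain ⟨σ, rfl⟩ := exists_eq_insertPoint hlast
    exact ⟨σ, mem_avoiders_iff_isAvoider.2 (isAvoider_insertPoint_last_iff.1 hπ), rfl⟩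
  · exact fun σ _ => congrArg _ (fpBelow_insertPoint_last σ).symm

theorem glue_mem_pointedAvoiders_iff {β γ : Perm (Fin (q + r))} {α : Perm (Fin (p + 1))}
    {a : Fin (p + 1)} (hβ : StrictMonoOn β {t | q ≤ t.val}) (hγ : StrictMonoOn γ {t | q ≤ t.val}) :
    (glue β γ α, mid a) ∈ pointedAvoiders (k + r) (q + (p + 1) + (q + r)) ∧
        cutSizes (glue β γ α) (mid a) = (r, 2 * q + r, p) ↔
      (β ∈ tailAvoiders (k + r) q (q + r) ∧ γ ∈ tailAvoiders (k + r) q (q + r)) ∧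
        (α, a) ∈ pointedAvoiders k (p + 1) ∧ a = Fin.last p := by
  have hcut : IsAvoider (k + r) (glue β γ α) ∧ α a = a →
      (cutSizes (glue β γ α) (mid a) = (r, 2 * q + r, p) ↔ a = Fin.last p) := by
    rintro ⟨h, ha⟩
    rw [cutSizes_eq_iff rfl h (by rw [glue_mid, ha]), and_iff_left (corner_glue α hβ hγ), val_mid,
      Nat.add_left_cancel_iff, Fin.ext_iff, Fin.val_last]
  simp only [mem_pointedAvoiders, mem_tailAvoiders, and_iff_left hβ, and_iff_left hγ, glue_mid,
    mid.eq_iff_eq]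
  rw [and_congr_right hcut, isAvoider_glue_iff hβ hγ]
  simp only [and_assoc]

theorem sum_pointedAvoiders_cutSizes_eq {R : Type*} [CommSemiring R] (x : R)
    (hn : q + (p + 1) + (q + r) = n) :
    ∑ y ∈ pointedAvoiders (k + r) n with cutSizes y.1 y.2 = (r, 2 * q + r, p),
        x ^ fpBelow y.1 y.2 =
      (stripPaths (k + r) (2 * q + r) r : R) ^ 2 *
        ∑ y ∈ pointedAvoiders k (p + 1) with y.2 = Fin.last p, x ^ fpBelow y.1 y.2 := by
  subst hn
  let triples := (tailAvoiders (k + r) q (q + r) ×ˢ tailAvoiders (k + r) q (q + r)) ×ˢ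
    {y ∈ pointedAvoiders k (p + 1) | y.2 = Fin.last p}
  have hglue : ∑ b ∈ triples, x ^ fpBelow b.2.1 b.2.2 =
      ∑ y ∈ pointedAvoiders (k + r) (q + (p + 1) + (q + r)) with
        cutSizes y.1 y.2 = (r, 2 * q + r, p), x ^ fpBelow y.1 y.2 := by
    refine sum_nbij (fun b => (glue b.1.1 b.1.2 b.2.1, mid b.2.2)) ?_ ?_ ?_ ?_
    · rintro ⟨⟨β, γ⟩, α, a⟩ hb
      simp only [triples, mem_product, mem_filter] at hb ⊢
      exact (glue_mem_pointedAvoiders_iff (mem_tailAvoiders.1 hb.1.1).2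
        (mem_tailAvoiders.1 hb.1.2).2).2 hb
    · rintro ⟨⟨β, γ⟩, α, a⟩ hb ⟨⟨β', γ'⟩, α', a'⟩ hb' heq
      simp only [triples, mem_coe, mem_product, mem_tailAvoiders] at hb hb'
      simp only [Prod.mk.injEq, mid.eq_iff_eq] at heq ⊢
      obtain ⟨hβ, hγ, hα⟩ := glue_injective hb.1.1.2 hb.1.2.2 hb'.1.1.2 hb'.1.2.2 heq.1
      exact ⟨⟨hβ, hγ⟩, hα, heq.2⟩
    · rintro ⟨π, i⟩ hy
      rw [mem_coe, mem_filter] at hy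
      obtain ⟨hπ, hfix⟩ := mem_pointedAvoiders.1 hy.1
      obtain ⟨hi, hcorner⟩ := (cutSizes_eq_iff rfl hπ hfix).1 hy.2
      obtain rfl : i = mid (Fin.last p) := Fin.ext hi
      obtain ⟨β, γ, α, hβ, hγ, rfl⟩ := hcorner.exists_eq_glue
      refine ⟨((β, γ), α, Fin.last p), ?_, rfl⟩
      simpa only [triples, mem_coe, mem_product, mem_filter] using
        (glue_mem_pointedAvoiders_iff hβ hγ).1 hy
    · exact fun b _ => congrArg _ (fpBelow_glue_mid _ _ _ _).symm
  rw [← hglue, sum_product]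
  simp only [sum_const, card_product, card_tailAvoiders_eq_stripPaths, nsmul_eq_mul, Nat.cast_mul,
    sq]

theorem coeff_M (k n : ℕ) : (M k).coeff n =
    ∑ π ∈ avoiders {pattern132, increasing (k + 1)} n, (Polynomial.X : Polynomial ℚ) ^ fp π := by
  change (F _ _ _).coeff n = _
  simp only [F, PowerSeries.coeff_mk, one_pow, mul_one]

theorem coeff_M_sub_one (k p : ℕ) : (M ((k : ℤ) - 1)).coeff p =
    ∑ y ∈ pointedAvoiders k (p + 1) with y.2 = Fin.last p,
      (Polynomial.X : Polynomial ℚ) ^ fpBelow y.1 y.2 := by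
  cases k with
  | zero =>
    rw [filter_eq_empty_iff.2 fun y hy => absurd (mem_pointedAvoiders.1 hy).1
      (not_isAvoider_zero y.1), sum_empty]
    exact map_zero _
  | succ k => rw [sum_pointedAvoiders_last, ← coeff_M, Nat.cast_succ, add_sub_cancel_right]

theorem sum_pointedAvoiders_cutSizes (h : p + a = n) :
    ∑ y ∈ pointedAvoiders (k + r) (n + 1) with cutSizes y.1 y.2 = (r, a, p),
        (Polynomial.X : Polynomial ℚ) ^ fpBelow y.1 y.2 =
      (stripPaths (k + r) a r : Polynomial ℚ) ^ 2 * (M ((k : ℤ) - 1)).coeff p := by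
  by_cases ha : ∃ q, 2 * q + r = a
  · obtain ⟨q, rfl⟩ := ha
    rw [sum_pointedAvoiders_cutSizes_eq _ (by omega), coeff_M_sub_one]
  · have hempty : stripPaths (k + r) a r = 0 :=
      of_not_not fun hne => ha (exists_of_stripPaths_ne_zero hne)
    rw [hempty, filter_eq_empty_iff.2 fun y _ hy => ha ?_, sum_empty]
    · simp
    · simp only [cutSizes, Prod.mk.injEq] at hy
      exact ⟨_, hy.1 ▸ hy.2.1⟩

theorem sum_pointedAvoiders (k n : ℕ) :
    ∑ y ∈ pointedAvoiders k (n + 1), (Polynomial.X : Polynomial ℚ) ^ fpBelow y.1 y.2 =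
      ∑ r ∈ range (k + 1), (G k (k - r) * M (((k - r : ℕ) : ℤ) - 1)).coeff n := by
  have hmaps : ∀ y ∈ pointedAvoiders k (n + 1),
      cutSizes y.1 y.2 ∈ range (k + 1) ×ˢ antidiagonal n := fun y hy =>
    cutSizes_mem (mem_pointedAvoiders.1 hy).1 (mem_pointedAvoiders.1 hy).2
  refine (sum_fiberwise_of_maps_to hmaps _).symm.trans ((sum_product _ _ _).trans ?_)
  refine sum_congr rfl fun r hr => ?_
  obtain ⟨l, rfl⟩ := Nat.exists_eq_add_of_le' (Nat.lt_succ_iff.1 (mem_range.1 hr))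
  rw [Nat.add_sub_cancel, PowerSeries.coeff_mul]
  refine sum_congr rfl fun s hs => ?_
  rw [coeff_G rfl, ← sum_pointedAvoiders_cutSizes
    ((add_comm _ _).trans (HasAntidiagonal.mem_antidiagonal.1 hs))]

theorem M_recurrence (k : ℕ) :
    M (k : ℤ) = ∑ l ∈ range (k + 1),
      G k l * (1 + PowerSeries.C (Polynomial.X - 1 : Polynomial ℚ) * PowerSeries.X *
        M ((l : ℤ) - 1)) := by
  rw [← sum_range_reflect]
  ext1 n
  have hterm : ∀ l, G k l * (1 + PowerSeries.C (Polynomial.X - 1 : Polynomial ℚ) *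
      PowerSeries.X * M ((l : ℤ) - 1)) = G k l + PowerSeries.C (Polynomial.X - 1 : Polynomial ℚ) *
      (PowerSeries.X * (G k l * M ((l : ℤ) - 1))) := fun l => by ring
  have hunpointed : (#(avoiders {pattern132, increasing (k + 1)} n) : Polynomial ℚ) =
      ∑ r ∈ range (k + 1), (G k (k - r)).coeff n := by
    rw [card_avoiders, Nat.cast_sum]
    refine sum_congr rfl fun r hr => ?_
    rw [coeff_G (Nat.sub_add_cancel (Nat.lt_succ_iff.1 (mem_range.1 hr))), Nat.cast_pow]
  have hpointed : ∑ y ∈ pointedAvoiders k n, (Polynomial.X : Polynomial ℚ) ^ fpBelow y.1 y.2 =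
      ∑ r ∈ range (k + 1),
        (PowerSeries.X * (G k (k - r) * M (((k - r : ℕ) : ℤ) - 1))).coeff n := by
    cases n with
    | zero =>
      rw [pointedAvoiders, univ_eq_empty, filter_empty, sum_empty]
      simp only [PowerSeries.coeff_zero_X_mul, sum_const_zero]
    | succ n => simp only [sum_pointedAvoiders, PowerSeries.coeff_succ_X_mul]
  rw [coeff_M, sum_avoiders_pow_fp, hunpointed, hpointed]
  simp only [hterm, map_sum, map_add, PowerSeries.coeff_C_mul, sum_add_distrib, mul_sum,
    Nat.add_sub_cancel]

end Recurrence

end PatternAvoid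

/-- The first two conjuncts say that the series defining `g_{k,ℓ}` makes sense: its denominator is
non-zero and the quotient is a power series `∑_{n ≥ 0} g_{k,ℓ}(n) z^n`. The last two are the initial
condition and the recurrence. -/
theorem mainTheorem5 (k : ℕ) :
    PatternAvoid.UL (k + 1) ≠ 0 ∧
    (∀ l ≤ k, HahnSeries.ofPowerSeries ℤ ℚ (PowerSeries.mk (PatternAvoid.g k l)) =
      PatternAvoid.UL l / (PatternAvoid.zL * PatternAvoid.UL (k + 1))) ∧
    PatternAvoid.M (-1) = 0 ∧
    PatternAvoid.M (k : ℤ) = ∑ l ∈ Finset.range (k + 1),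
      PatternAvoid.G k l *
        (1 + PowerSeries.C (Polynomial.X - 1 : Polynomial ℚ) * PowerSeries.X *
          PatternAvoid.M ((l : ℤ) - 1)) := by
  exact ⟨PatternAvoid.UL_succ_ne_zero k, fun _ h => PatternAvoid.ofPowerSeries_mk_g h, rfl,
    PatternAvoid.M_recurrence k⟩
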